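/- There is a universal constant $\mathfrak c>1$ such that the following holds. Let $d,T\ge 1$ and $k\ge 0$ be integers, let $\mathbf M\in\mathbb R^{d\times T}$ be a deterministic matrix, and suppose that we observe $\mathbf X=\mathbf M+\varepsilon$, where $\varepsilon$ is a random $d\times T$ real matrix satisfying: - the rows of $\varepsilon$ are independent and have the same sub-Gaussian distribution on $\mathbb R^T$, i.e. $\sup_{\|x\|=1}\sup_{p\ge1}p^{-1/2}\,\mathbb E(|\langle\varepsilon_{1,\cdot},x\rangle|^p)^{1/p}<\infty$; write $\Sigma_\varepsilon=\mathbb E(\varepsilon_{1,\cdot}^*\varepsilon_{1,\cdot})$ for the second-moment matrix of the (row) vector $\varepsilon_{1,\cdot}$; - $\varepsilon_{1,\cdot}\Sigma_\varepsilon^{-1/2}$ is isotropic (its second-moment matrix is the identity; in particular $\Sigma_\varepsilon$ is invertible) and has finite sub-Gaussian norm $$\mathfrak K_\varepsilon:=\sup_{\|x\|=1}\ \sup_{p\in[1,\infty)}p^{-1/2}\,\mathbb E\big(|\langle\varepsilon_{1,\cdot}\Sigma_\varepsilon^{-1/2},x\rangle|^p\big)^{1/p}<\infty .$$ Put $\widetilde{\mathfrak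 K}_\varepsilon:=\max(\mathfrak K_\varepsilon^2,\mathfrak K_\varepsilon^4)$, let $\|\mathbf A\|_F=\mathrm{trace}(\mathbf A\mathbf A^*)^{1/2}$ be the Frobenius norm and $\|\cdot\|_{\rm op}$ the operator norm for the Euclidean norm. Let $\mathcal S\subseteq\mathbb R^{d\times T}$ be a set of matrices of rank at most $k$, and let $\widehat{\mathbf M}_{\mathcal S}$ be a least-squares estimator over $\mathcal S$: almost surely, $\widehat{\mathbf M}_{\mathcal S}\in\arg\min_{\mathbf A\in\mathcal S}\|\mathbf A-\mathbf X\|_F^2$. Then for every $\lambda\in(0,1)$ and every $s\ge 0$, with probability at least $1-2e^{-s}$, $$\frac1{dT}\big\|\widehat{\mathbf M}_{\mathcal S}-\mathbf M\big\|_F^2\le\frac{1+\lambda}{1-\lambda}\cdot\inf_{\mathbf A\in\mathcal S}\frac1{dT}\|\mathbf A-\mathbf M\|_F^2+\frac{4\,\mathfrak c\,\widetilde{\mathfrak K}_\varepsilon\|\Sigma_\varepsilon\|_{\rm op}}{\lambda(1-\lambda)}\cdot\frac{k(d+T+s)}{dT},$$ and, on the same event, if $\mathbf M\in\mathcal S$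 then $$\frac1{dT}\big\|\widehat{\mathbf M}_{\mathcal S}-\mathbf M\big\|_F^2\le\frac{4\,\mathfrak c\,\widetilde{\mathfrak K}_\varepsilon\|\Sigma_\varepsilon\|_{\rm op}}{\lambda(1-\lambda)}\cdot\frac{k(d+T+s)}{dT}\le\frac{4\,\mathfrak c\,(1+s)\,\widetilde{\mathfrak K}_\varepsilon}{\lambda(1-\lambda)}\cdot\|\Sigma_\varepsilon\|_{\rm op}\frac{k(d+T)}{dT},$$ which is the rate $\mathcal O\big(\|\Sigma_\varepsilon\|_{\rm op}\,k(d+T)/(dT)\big)$ for fixed $\lambda$, $s$ and $\mathfrak K_\varepsilon$. -/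

import Mathlib

open MeasureTheory ProbabilityTheory
open scoped ENNReal Matrix MatrixOrder

noncomputable section

namespace LowRankOracle

/-- The Frobenius norm `trace(A Aᵀ)^{1/2}` of a real matrix. -/
def frobeniusNorm {d T : ℕ} (A : Matrix (Fin d) (Fin T) ℝ) : ℝ :=
  Real.sqrt (A * Aᵀ).trace

/-- The operator norm of a square real matrix for the Euclidean norm. -/
def opNorm {T : ℕ} (A : Matrix (Fin T) (Fin T) ℝ) : ℝ :=
  ‖Matrix.toEuclideanCLM (n := Fin T) (𝕜 := ℝ) A‖

variable {Ω : Type*} [MeasurableSpace Ω]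

/-- The second moment matrix `E(Yᵀ Y)` of a random row vector `Y`. -/
def secondMoment {T : ℕ} (μ : Measure Ω) (Y : Ω → Fin T → ℝ) : Matrix (Fin T) (Fin T) ℝ :=
  Matrix.of fun t t' => ∫ ω, Y ω t * Y ω t' ∂μ

/-- The sub-Gaussian norm `sup_{‖x‖ = 1} sup_{p ≥ 1} p^{-1/2} E(|⟨Y, x⟩|^p)^{1/p}` of a random
vector, as an extended nonnegative real. -/
def subGaussianNorm {T : ℕ} (μ : Measure Ω) (Y : Ω → Fin T → ℝ) : ℝ≥0∞ :=
  ⨆ (x : EuclideanSpace ℝ (Fin T)) (_ : ‖x‖ = 1) (p : ℝ) (_ : 1 ≤ p),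
    ENNReal.ofReal (p ^ (-(1 / 2) : ℝ)) *
      eLpNorm (fun ω => Y ω ⬝ᵥ x.ofLp) (ENNReal.ofReal p) μ

/-- The normalized random row vector `Y Σ^{-1/2}`, where `Σ` is the second moment matrix of `Y`. -/
def whiten {T : ℕ} (μ : Measure Ω) (Y : Ω → Fin T → ℝ) : Ω → Fin T → ℝ :=
  fun ω => Y ω ᵥ* (CFC.sqrt (secondMoment μ Y))⁻¹

section Noise

variable {d T : ℕ} [NeZero d]

/-- The second moment matrix of the (first) row of the noise. -/
def noiseCov (μ : Measure Ω) (ε : Ω → Matrix (Fin d) (Fin T) ℝ) : Matrix (Fin T) (Fin T) ℝ :=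
  secondMoment μ fun ω => ε ω 0

/-- The sub-Gaussian norm of the normalized (first) row of the noise. It is meaningful when
`subGaussianNorm μ (whiten μ fun ω => ε ω 0)` is finite, which `IsSubGaussianNoise` requires. -/
def noiseK (μ : Measure Ω) (ε : Ω → Matrix (Fin d) (Fin T) ℝ) : ℝ :=
  (subGaussianNorm μ (whiten μ fun ω => ε ω 0)).toReal

/-- The maximum of the square and of the fourth power of `noiseK`. -/
def noiseKTilde (μ : Measure Ω) (ε : Ω → Matrix (Fin d) (Fin T) ℝ) : ℝ :=
  max (noiseK μ ε ^ 2) (noiseK μ ε ^ 4)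

/-- The rows of the random matrix `ε` are independent, with the same sub-Gaussian distribution, and
the normalized first row is isotropic (its second moment matrix is the identity, which forces the
second moment matrix of the row to be invertible) with finite sub-Gaussian norm. -/
structure IsSubGaussianNoise (μ : Measure Ω) (ε : Ω → Matrix (Fin d) (Fin T) ℝ) : Prop where
  measurable : ∀ i t, Measurable fun ω => ε ω i t
  indep : iIndepFun (fun (i : Fin d) (ω : Ω) => (ε ω i : Fin T → ℝ)) μ
  identDistrib : ∀ i : Fin d,
    IdentDistrib (fun ω => (ε ω i : Fin T → ℝ)) (fun ω => (ε ω 0 : Fin T → ℝ)) μ μ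
  subGaussian : subGaussianNorm μ (fun ω => ε ω 0) < ∞
  isotropic : secondMoment μ (whiten μ fun ω => ε ω 0) = 1
  whiten_subGaussian : subGaussianNorm μ (whiten μ fun ω => ε ω 0) < ∞

end Noise

/-- `A` minimizes the squared Frobenius distance to the data `X` over the set `S`. -/
def IsLeastSquares {d T : ℕ} (S : Set (Matrix (Fin d) (Fin T) ℝ))
    (X A : Matrix (Fin d) (Fin T) ℝ) : Prop :=
  A ∈ S ∧ IsMinOn (fun B => frobeniusNorm (B - X) ^ 2) S A

end LowRankOracle

end

/-! Minimality of the estimator `Mhat` against a competitor `A` in `S` gives `‖Mhat - M‖² ≤ ‖A - M‖²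
+ 2⟨Mhat - A, ε⟩`. Since `Mhat - A` has rank at most `2k`, trace duality (`sq_sum_mul_le`) bounds
the cross term by `√(2k) ‖ε‖_op ‖Mhat - A‖_F`, and Young's inequality absorbs it into both squared
errors (`IsLeastSquares.oracle`). All randomness thus enters through `‖ε‖_op²`.

That norm is controlled by whitening: `ε = W Σ^{1/2}`, where `W` has independent sub-Gaussian rows.
For a fixed unit `x`, `‖W x‖²` is a sum of independent squares with exponential moments, so Chernoff
applies; a union bound over a `1/2`-net of the sphere makes the bound uniform in `x`
(`IsSubGaussianNoise.exists_event`). One event serves every competitor `A`. -/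

namespace LowRankOracle

/-! ### Deterministic oracle inequality. -/

theorem frobeniusNorm_sq {d T : ℕ} (A : Matrix (Fin d) (Fin T) ℝ) :
    frobeniusNorm A ^ 2 = ∑ i, ∑ j, A i j ^ 2 := by
  have h : (A * Aᵀ).trace = ∑ i, ∑ j, A i j ^ 2 := by
    simp [Matrix.trace, Matrix.mul_apply, sq]
  rw [frobeniusNorm, h, Real.sq_sqrt (by positivity)]

theorem rank_sub_le {d T : ℕ} (A B : Matrix (Fin d) (Fin T) ℝ) :
    (A - B).rank ≤ A.rank + B.rank := by
  refine le_trans (Submodule.finrank_mono (?_ : _ ≤ A.mulVecLin.range ⊔ B.mulVecLin.range))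
    (Submodule.finrank_add_le_finrank_add_finrank _ _)
  rintro _ ⟨x, rfl⟩
  rw [Matrix.mulVecLin_apply, Matrix.sub_mulVec]
  exact Submodule.sub_mem _ (Submodule.mem_sup_left ⟨x, rfl⟩) (Submodule.mem_sup_right ⟨x, rfl⟩)

/-- The trace duality inequality `⟨B, E⟩² ≤ rank B · ‖E‖² · ‖B‖_F²`. -/
theorem sq_sum_mul_le {d T : ℕ} (B E : Matrix (Fin d) (Fin T) ℝ) (L : ℝ)
    (hE : ∀ x : EuclideanSpace ℝ (Fin T), ∑ i, (E i ⬝ᵥ x.ofLp) ^ 2 ≤ L * ‖x‖ ^ 2) :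
    (∑ i, ∑ j, B i j * E i j) ^ 2 ≤ B.rank * L * frobeniusNorm B ^ 2 := by
  set e := (WithLp.linearEquiv 2 ℝ (Fin T → ℝ)).symm
  -- Expanding the rows of `B` in an orthonormal basis of its row space leaves only `rank B`
  -- directions in which `E` is tested; Cauchy–Schwarz then suffices, without singular values.
  set R : Submodule ℝ (EuclideanSpace ℝ (Fin T)) :=
    (Submodule.span ℝ (Set.range B.row)).map e.toLinearMap with hR
  have hrank : Module.finrank ℝ R = B.rank := by
    rw [Matrix.rank_eq_finrank_span_row, hR]
    exact LinearEquiv.finrank_map_eq e _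
  let u := stdOrthonormalBasis ℝ R
  let b : Fin d → R := fun i =>
    ⟨WithLp.toLp 2 (B i), Submodule.mem_map_of_mem (f := e.toLinearMap)
      (Submodule.subset_span ⟨i, rfl⟩)⟩
  have hinner (x y : EuclideanSpace ℝ (Fin T)) : inner ℝ x y = x.ofLp ⬝ᵥ y.ofLp := by
    simp [PiLp.inner_apply, dotProduct, mul_comm]
  have h1 (i : Fin d) : ∑ j, B i j * E i j =
      ∑ m, inner ℝ (b i) (u m) * (E i ⬝ᵥ (u m : EuclideanSpace ℝ (Fin T)).ofLp) := by
    have hb : (b i : EuclideanSpace ℝ (Fin T)) = ∑ m, inner ℝ (u m) (b i) •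
        (u m : EuclideanSpace ℝ (Fin T)) := by
      conv_lhs => rw [← u.sum_repr' (b i)]
      simp
    have h2 : ∑ j, B i j * E i j =
        inner ℝ (b i : EuclideanSpace ℝ (Fin T)) (WithLp.toLp 2 (E i)) := by
      rw [hinner]; rfl
    rw [h2, hb, sum_inner]
    refine Finset.sum_congr rfl fun m _ => ?_
    rw [real_inner_smul_left, hinner, real_inner_comm, dotProduct_comm]
  have h2 : ∑ i, ∑ m, inner ℝ (b i) (u m) ^ 2 = frobeniusNorm B ^ 2 := by
    rw [frobeniusNorm_sq]
    refine Finset.sum_congr rfl fun i _ => ?_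
    have := u.sum_sq_norm_inner_left (b i)
    simp only [Real.norm_eq_abs, sq_abs] at this
    rw [this, Submodule.coe_norm, EuclideanSpace.norm_sq_eq]
    simp [b]
  have h3 : ∑ i, ∑ m, (E i ⬝ᵥ (u m : EuclideanSpace ℝ (Fin T)).ofLp) ^ 2 ≤ B.rank * L := by
    rw [Finset.sum_comm]
    refine (Finset.sum_le_sum fun m _ => hE (u m)).trans ?_
    have hu (m) : ‖(u m : EuclideanSpace ℝ (Fin T))‖ = 1 := u.norm_eq_one m
    simp [hu, hrank]
  simp_rw [h1]
  rw [← Fintype.sum_prod_type']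
  refine (Finset.sum_mul_sq_le_sq_mul_sq _ _ _).trans ?_
  rw [Fintype.sum_prod_type, Fintype.sum_prod_type, h2, mul_comm]
  exact mul_le_mul_of_nonneg_right h3 (sq_nonneg _)

/-- The deterministic oracle inequality for least squares over matrices of rank at most `k`. -/
theorem IsLeastSquares.oracle {d T k : ℕ} {S : Set (Matrix (Fin d) (Fin T) ℝ)}
    (hS : ∀ A ∈ S, A.rank ≤ k) {M E Mhat A : Matrix (Fin d) (Fin T) ℝ}
    (h : IsLeastSquares S (M + E) Mhat) (hA : A ∈ S) {L : ℝ} (hL : 0 ≤ L)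
    (hE : ∀ x : EuclideanSpace ℝ (Fin T), ∑ i, (E i ⬝ᵥ x.ofLp) ^ 2 ≤ L * ‖x‖ ^ 2)
    {lam : ℝ} (h0 : 0 < lam) (h1 : lam < 1) :
    frobeniusNorm (Mhat - M) ^ 2 ≤
      (1 + lam) / (1 - lam) * frobeniusNorm (A - M) ^ 2 + 4 * k * L / (lam * (1 - lam)) := by
  set c := ∑ i, ∑ j, (Mhat - A) i j * E i j with hc
  have hmin : frobeniusNorm (Mhat - (M + E)) ^ 2 ≤ frobeniusNorm (A - (M + E)) ^ 2 := h.2 hA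
  have hbasic : frobeniusNorm (Mhat - M) ^ 2 ≤ frobeniusNorm (A - M) ^ 2 + 2 * c := by
    have : frobeniusNorm (Mhat - M) ^ 2 - frobeniusNorm (A - M) ^ 2 - 2 * c =
        frobeniusNorm (Mhat - (M + E)) ^ 2 - frobeniusNorm (A - (M + E)) ^ 2 := by
      simp only [hc, frobeniusNorm_sq, Finset.mul_sum, ← Finset.sum_sub_distrib]
      refine Finset.sum_congr rfl fun i _ => Finset.sum_congr rfl fun j _ => ?_
      simp only [Matrix.sub_apply, Matrix.add_apply]
      ring
    linarith
  have hpar : frobeniusNorm (Mhat - A) ^ 2 ≤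
      2 * frobeniusNorm (Mhat - M) ^ 2 + 2 * frobeniusNorm (A - M) ^ 2 := by
    simp only [frobeniusNorm_sq, Finset.mul_sum, ← Finset.sum_add_distrib]
    refine Finset.sum_le_sum fun i _ => Finset.sum_le_sum fun j _ => ?_
    simp only [Matrix.sub_apply]
    nlinarith [sq_nonneg ((Mhat i j - M i j) + (A i j - M i j))]
  have hr : ((Mhat - A).rank : ℝ) ≤ 2 * k := by
    have := (rank_sub_le Mhat A).trans (add_le_add (hS _ h.1) (hS _ hA))
    have h' : (Mhat - A).rank ≤ 2 * k := by omega
    exact_mod_cast h'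
  have hdual : c ^ 2 ≤ 2 * k * L * frobeniusNorm (Mhat - A) ^ 2 :=
    (sq_sum_mul_le _ _ L hE).trans (by gcongr)
  -- The two summands have product `2kLr ≥ c²`, so AM-GM applies. The weight `lam / 2` becomes `lam`
  -- on each squared error through `hpar`.
  have hyoung : 2 * c ≤ lam / 2 * frobeniusNorm (Mhat - A) ^ 2 + 4 * k * L / lam := by
    set r := frobeniusNorm (Mhat - A) ^ 2
    have hr0 : 0 ≤ r := sq_nonneg _
    have hq : 0 ≤ 4 * k * L / lam := by positivity
    refine le_of_sq_le_sq ?_ (by positivity)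
    have : lam / 2 * r * (4 * k * L / lam) = 2 * k * L * r := by field_simp; ring
    nlinarith [sq_nonneg (lam / 2 * r - 4 * k * L / lam)]
  have h1' : 0 < 1 - lam := by linarith
  have key : (1 - lam) * frobeniusNorm (Mhat - M) ^ 2 ≤
      (1 + lam) * frobeniusNorm (A - M) ^ 2 + 4 * k * L / lam := by
    nlinarith
  have e : (1 + lam) / (1 - lam) * frobeniusNorm (A - M) ^ 2 + 4 * k * L / (lam * (1 - lam)) =
      ((1 + lam) * frobeniusNorm (A - M) ^ 2 + 4 * k * L / lam) / (1 - lam) := by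
    field_simp
  rw [e, le_div_iff₀ h1']
  linarith

/-! ### Exponential moments and tails of sums of squares. -/

section Probability

variable {Ω : Type*} [MeasurableSpace Ω] {μ : Measure Ω}

theorem lintegral_even_moment_le {Z : Ω → ℝ} {κ : ℝ} (hκ : 0 ≤ κ)
    (h : ∀ p : ℝ, 1 ≤ p → eLpNorm Z (ENNReal.ofReal p) μ ≤ ENNReal.ofReal (κ * √p))
    {n : ℕ} (hn : n ≠ 0) :
    ∫⁻ ω, ENNReal.ofReal ((Z ω ^ 2) ^ n) ∂μ ≤ ENNReal.ofReal ((κ ^ 2 * (2 * n)) ^ n) := by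
  have hn1 : (1 : ℝ) ≤ n := by exact_mod_cast Nat.one_le_iff_ne_zero.2 hn
  have h1 := h (2 * n) (by linarith)
  have hp : ENNReal.ofReal (2 * n) = ((2 * n : ℕ) : NNReal) := by
    rw [← ENNReal.ofReal_coe_nnreal]; simp
  rw [hp] at h1
  have h2 := eLpNorm_nnreal_pow_eq_lintegral (μ := μ) (f := Z) (p := ((2 * n : ℕ) : NNReal))
    (by positivity)
  have h3 : ∫⁻ ω, ENNReal.ofReal ((Z ω ^ 2) ^ n) ∂μ =
      eLpNorm Z ((2 * n : ℕ) : NNReal) μ ^ (2 * n) := by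
    rw [NNReal.coe_natCast, ENNReal.rpow_natCast] at h2
    rw [h2]
    refine lintegral_congr fun ω => ?_
    rw [ENNReal.rpow_natCast, ← ofReal_norm, ← ENNReal.ofReal_pow (norm_nonneg _),
      pow_mul, Real.norm_eq_abs, sq_abs]
  rw [h3]
  refine (pow_le_pow_left' h1 _).trans_eq ?_
  rw [← ENNReal.ofReal_pow (by positivity), pow_mul, mul_pow, Real.sq_sqrt (by positivity)]

/-- The square of a sub-Gaussian variable has an exponential moment. -/
theorem lintegral_exp_sq_le [IsProbabilityMeasure μ] {Z : Ω → ℝ} (hZ : Measurable Z) {κ : ℝ}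
    (hκ : 0 < κ)
    (h : ∀ p : ℝ, 1 ≤ p → eLpNorm Z (ENNReal.ofReal p) μ ≤ ENNReal.ofReal (κ * √p)) :
    ∫⁻ ω, ENNReal.ofReal (Real.exp ((4 * Real.exp 1 * κ ^ 2)⁻¹ * Z ω ^ 2)) ∂μ ≤ 2 := by
  -- Chosen so that `2eθκ² = 1/2`: with `n ^ n / n! ≤ e ^ n`, the exponential series is dominated by
  -- the geometric series of sum `2`.
  set θ := (4 * Real.exp 1 * κ ^ 2)⁻¹ with hθ
  have hθ0 : 0 < θ := by positivity
  have hexp (x : ℝ) (hx : 0 ≤ x) :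
      ENNReal.ofReal (Real.exp x) = ∑' n : ℕ, ENNReal.ofReal (x ^ n / n.factorial) := by
    rw [← ENNReal.ofReal_tsum_of_nonneg (fun n => by positivity) (Real.summable_pow_div_factorial x),
      Real.exp_eq_exp_ℝ, NormedSpace.exp_eq_tsum_div]
  have hterm (n : ℕ) : ∫⁻ ω, ENNReal.ofReal ((θ * Z ω ^ 2) ^ n / n.factorial) ∂μ ≤
      ENNReal.ofReal ((1 / 2) ^ n) := by
    rcases eq_or_ne n 0 with rfl | hn
    · simp
    have e (ω : Ω) : ENNReal.ofReal ((θ * Z ω ^ 2) ^ n / n.factorial) =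
        ENNReal.ofReal (θ ^ n / n.factorial) * ENNReal.ofReal ((Z ω ^ 2) ^ n) := by
      rw [← ENNReal.ofReal_mul (by positivity)]
      congr 1
      ring
    simp_rw [e]
    rw [lintegral_const_mul _ (by fun_prop)]
    refine (mul_le_mul_right (lintegral_even_moment_le hκ.le h hn) _).trans ?_
    rw [← ENNReal.ofReal_mul (by positivity)]
    refine ENNReal.ofReal_le_ofReal ?_
    have hf : (n : ℝ) ^ n / n.factorial ≤ Real.exp 1 ^ n := by
      rw [← Real.exp_nat_mul, mul_one]
      exact Real.pow_div_factorial_le_exp _ (Nat.cast_nonneg n) n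
    calc θ ^ n / n.factorial * (κ ^ 2 * (2 * n)) ^ n
        = (θ * κ ^ 2 * 2) ^ n * ((n : ℝ) ^ n / n.factorial) := by
          simp only [mul_pow]; ring
      _ ≤ (θ * κ ^ 2 * 2) ^ n * Real.exp 1 ^ n := by gcongr
      _ = (1 / 2) ^ n := by
          rw [← mul_pow]
          congr 1
          rw [hθ]
          field_simp
          norm_num
  have hrw (ω : Ω) := hexp (θ * Z ω ^ 2) (by positivity)
  simp_rw [hrw]
  rw [lintegral_tsum fun n => by fun_prop]
  refine (ENNReal.tsum_le_tsum hterm).trans_eq ?_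
  rw [← ENNReal.ofReal_tsum_of_nonneg (fun n => by positivity) summable_geometric_two,
    tsum_geometric_two]
  simp

/-- Chernoff's bound for a sum of squares of independent variables. -/
theorem measure_sum_sq_ge_le [IsProbabilityMeasure μ] {d : ℕ} {Z : Fin d → Ω → ℝ}
    (hZ : ∀ i, Measurable (Z i)) (hind : iIndepFun Z μ) {θ : ℝ} (hθ : 0 < θ)
    (h : ∀ i, ∫⁻ ω, ENNReal.ofReal (Real.exp (θ * Z i ω ^ 2)) ∂μ ≤ 2) (t : ℝ) :
    μ {ω | t ≤ ∑ i, Z i ω ^ 2} ≤ 2 ^ d * ENNReal.ofReal (Real.exp (-(θ * t))) := by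
  have hind' : iIndepFun (fun i ω => ENNReal.ofReal (Real.exp (θ * Z i ω ^ 2))) μ :=
    hind.comp (fun _ x => ENNReal.ofReal (Real.exp (θ * x ^ 2))) fun _ => by fun_prop
  have hprod : ∫⁻ ω, ENNReal.ofReal (Real.exp (θ * ∑ i, Z i ω ^ 2)) ∂μ ≤ 2 ^ d := by
    have e (ω : Ω) : ENNReal.ofReal (Real.exp (θ * ∑ i, Z i ω ^ 2)) =
        ∏ i, ENNReal.ofReal (Real.exp (θ * Z i ω ^ 2)) := by
      rw [Finset.mul_sum, Real.exp_sum, ENNReal.ofReal_prod_of_nonneg fun i _ => by positivity]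
    simp_rw [e]
    rw [lintegral_prod_eq_prod_lintegral_of_indepFun _ _ hind' fun i => by
      have := hZ i
      fun_prop]
    exact (Finset.prod_le_prod' fun i _ => h i).trans_eq (by simp)
  have hmarkov := mul_meas_ge_le_lintegral (μ := μ)
    (f := fun ω => ENNReal.ofReal (Real.exp (θ * ∑ i, Z i ω ^ 2))) (by fun_prop)
    (ENNReal.ofReal (Real.exp (θ * t)))
  have hsub : {ω | t ≤ ∑ i, Z i ω ^ 2} ⊆ {ω | ENNReal.ofReal (Real.exp (θ * t)) ≤
      ENNReal.ofReal (Real.exp (θ * ∑ i, Z i ω ^ 2))} := fun ω hω =>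
    ENNReal.ofReal_le_ofReal (Real.exp_le_exp.2 (mul_le_mul_of_nonneg_left hω hθ.le))
  rw [Real.exp_neg, ENNReal.ofReal_inv_of_pos (Real.exp_pos _), ← div_eq_mul_inv,
    ENNReal.le_div_iff_mul_le (by simp [Real.exp_pos]) (by simp), mul_comm]
  exact (mul_le_mul_right (measure_mono hsub) _).trans (hmarkov.trans hprod)

end Probability

/-! ### Nets of the unit sphere and operator norms. -/

section Net

variable {E F : Type*} [NormedAddCommGroup E] [NormedSpace ℝ E]
  [NormedAddCommGroup F] [NormedSpace ℝ F]

/-- The unit sphere has a `1/2`-net with at most `5 ^ dim` elements. -/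
theorem exists_net_sphere [FiniteDimensional ℝ E] : ∃ s : Finset E, s.card ≤ 5 ^ Module.finrank ℝ E ∧
    (∀ c ∈ s, ‖c‖ = 1) ∧ ∀ x : E, ‖x‖ = 1 → ∃ c ∈ s, ‖x - c‖ ≤ 1 / 2 := by
  classical
  let P : ℕ → Prop := fun n => ∃ s : Finset E, s.card = n ∧ (∀ c ∈ s, ‖c‖ = 1) ∧
    ∀ c ∈ s, ∀ d ∈ s, c ≠ d → 1 / 2 ≤ ‖c - d‖
  have hcard (s : Finset E) (h1 : ∀ c ∈ s, ‖c‖ = 1)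
      (h2 : ∀ c ∈ s, ∀ d ∈ s, c ≠ d → 1 / 2 ≤ ‖c - d‖) : s.card ≤ 5 ^ Module.finrank ℝ E := by
    -- Doubling turns `1/2`-separated unit vectors into `1`-separated points of the ball of radius
    -- `2`, the normalization of the packing bound.
    have hinj : Function.Injective fun c : E => (2 : ℝ) • c :=
      smul_right_injective E (two_ne_zero)
    rw [← Finset.card_image_of_injective s hinj]
    refine Besicovitch.card_le_of_separated _ ?_ ?_
    · simp only [Finset.mem_image]
      rintro _ ⟨c, hc, rfl⟩
      simp [norm_smul, h1 c hc]
    · simp only [Finset.mem_image]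
      rintro _ ⟨c, hc, rfl⟩ _ ⟨d, hd, rfl⟩ hne
      have := h2 c hc d hd fun h => hne (by rw [h])
      rw [← smul_sub, norm_smul, Real.norm_eq_abs, abs_two]
      linarith
  have hP0 : P 0 := ⟨∅, by simp⟩
  -- A separated set of maximal cardinality is a net: a point far from all of it could be added.
  obtain ⟨s, hs, h1, h2⟩ := Nat.findGreatest_spec (P := P)
    (Nat.zero_le (5 ^ Module.finrank ℝ E)) hP0
  refine ⟨s, hcard s h1 h2, h1, fun x hx => ?_⟩
  by_contra! hfar
  have hxs : x ∉ s := fun h => by simpa using (hfar x h).le.trans_lt (by simp : ‖x - x‖ < 1 / 2)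
  have h1' : ∀ c ∈ insert x s, ‖c‖ = 1 := by
    simpa [Finset.forall_mem_insert] using ⟨hx, h1⟩
  have h2' : ∀ c ∈ insert x s, ∀ d ∈ insert x s, c ≠ d → 1 / 2 ≤ ‖c - d‖ := by
    intro c hc d hd hne
    rcases Finset.mem_insert.1 hc with rfl | hc' <;> rcases Finset.mem_insert.1 hd with rfl | hd'
    · exact absurd rfl hne
    · exact (hfar d hd').le
    · rw [norm_sub_rev]; exact (hfar c hc').le
    · exact h2 c hc' d hd' hne
  have := Nat.le_findGreatest (P := P) (hcard _ h1' h2') ⟨insert x s, rfl, h1', h2'⟩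
  rw [Finset.card_insert_of_notMem hxs] at this
  omega

/-- The error of approximating by the net costs at most `‖f‖ / 2`, which is absorbed on the left. -/
theorem opNorm_le_of_net {s : Finset E} (hs : ∀ x : E, ‖x‖ = 1 → ∃ c ∈ s, ‖x - c‖ ≤ 1 / 2)
    (f : E →L[ℝ] F) {b : ℝ} (hb0 : 0 ≤ b) (hb : ∀ c ∈ s, ‖f c‖ ≤ b) : ‖f‖ ≤ 2 * b := by
  have h : ‖f‖ ≤ b + ‖f‖ / 2 := by
    refine f.opNorm_le_of_unit_norm (by positivity) fun x hx => ?_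
    obtain ⟨c, hc, hxc⟩ := hs x hx
    calc ‖f x‖ = ‖f c + f (x - c)‖ := by rw [← map_add]; congr 2; abel
      _ ≤ ‖f c‖ + ‖f (x - c)‖ := norm_add_le _ _
      _ ≤ b + ‖f‖ * (1 / 2) := add_le_add (hb c hc) (f.le_opNorm_of_le hxc)
      _ = _ := by ring
  linarith

end Net

/-! ### Operator norm of the noise. -/

section NoiseBound

variable {Ω : Type*} [MeasurableSpace Ω] {μ : Measure Ω}

theorem eLpNorm_le_of_subGaussianNorm {T : ℕ} {Y : Ω → Fin T → ℝ}
    (hY : subGaussianNorm μ Y < ∞) {x : EuclideanSpace ℝ (Fin T)} (hx : ‖x‖ = 1) {p : ℝ}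
    (hp : 1 ≤ p) :
    eLpNorm (fun ω => Y ω ⬝ᵥ x.ofLp) (ENNReal.ofReal p) μ ≤
      ENNReal.ofReal ((subGaussianNorm μ Y).toReal * √p) := by
  have h : ENNReal.ofReal (p ^ (-(1 / 2) : ℝ)) *
      eLpNorm (fun ω => Y ω ⬝ᵥ x.ofLp) (ENNReal.ofReal p) μ ≤ subGaussianNorm μ Y :=
    le_iSup₂_of_le x hx (le_iSup₂_of_le p hp le_rfl)
  have hp0 : 0 < p := by linarith
  have hone : ENNReal.ofReal √p * ENNReal.ofReal (p ^ (-(1 / 2) : ℝ)) = 1 := by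
    rw [← ENNReal.ofReal_mul (by positivity), Real.sqrt_eq_rpow, ← Real.rpow_add hp0]
    simp
  rw [mul_comm, ENNReal.ofReal_mul (by positivity), ENNReal.ofReal_toReal hY.ne]
  calc _ = ENNReal.ofReal √p * (ENNReal.ofReal (p ^ (-(1 / 2) : ℝ)) *
      eLpNorm (fun ω => Y ω ⬝ᵥ x.ofLp) (ENNReal.ofReal p) μ) := by rw [← mul_assoc, hone, one_mul]
    _ ≤ _ := mul_le_mul_right h _

/-- By symmetry of the root, the left side is `⟨A x, x⟩`. -/
theorem norm_sqrt_mulVec_sq_le {T : ℕ} {A : Matrix (Fin T) (Fin T) ℝ} (hA : 0 ≤ A)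
    (x : EuclideanSpace ℝ (Fin T)) :
    ‖WithLp.toLp 2 (CFC.sqrt A *ᵥ x.ofLp)‖ ^ 2 ≤ opNorm A * ‖x‖ ^ 2 := by
  have hsymm : (CFC.sqrt A)ᵀ = CFC.sqrt A :=
    (Matrix.nonneg_iff_posSemidef.1 (CFC.sqrt_nonneg A)).isHermitian
  have h1 : ‖WithLp.toLp 2 (CFC.sqrt A *ᵥ x.ofLp)‖ ^ 2 =
      inner ℝ (Matrix.toEuclideanCLM (n := Fin T) (𝕜 := ℝ) A x) x := by
    have h2 : Matrix.toEuclideanCLM (n := Fin T) (𝕜 := ℝ) A x = WithLp.toLp 2 (A *ᵥ x.ofLp) := rfl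
    rw [h2, ← real_inner_self_eq_norm_sq, EuclideanSpace.inner_eq_star_dotProduct,
      EuclideanSpace.inner_eq_star_dotProduct]
    simp only [star_trivial]
    rw [Matrix.dotProduct_mulVec, ← Matrix.mulVec_transpose, hsymm, Matrix.mulVec_mulVec,
      CFC.sqrt_mul_sqrt_self A hA, dotProduct_comm]
  rw [h1, sq, ← mul_assoc]
  exact (real_inner_le_norm _ _).trans
    (mul_le_mul_of_nonneg_right (ContinuousLinearMap.le_opNorm _ _) (norm_nonneg _))

variable {d T : ℕ} [NeZero d] {ε : Ω → Matrix (Fin d) (Fin T) ℝ}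

/-- The inverse of a singular matrix is `0` by convention, so the whitened row would vanish, against
isotropy. -/
theorem IsSubGaussianNoise.isUnit_sqrt_noiseCov (hε : IsSubGaussianNoise μ ε) (hT : 1 ≤ T) :
    IsUnit (CFC.sqrt (noiseCov μ ε)).det := by
  by_contra h
  have := congrFun₂ hε.isotropic ⟨0, hT⟩ ⟨0, hT⟩
  have h0 : (CFC.sqrt (secondMoment μ fun ω => ε ω 0))⁻¹ = 0 :=
    Matrix.nonsing_inv_apply_not_isUnit _ h
  have hw : (whiten μ fun ω => ε ω 0) = 0 := by
    funext ω
    simp only [whiten, h0]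
    exact Matrix.vecMul_zero _
  rw [hw] at this
  simp [secondMoment] at this

/-- `CFC.sqrt` takes the value `0` off the nonnegative matrices, which would contradict
invertibility of the root. -/
theorem IsSubGaussianNoise.noiseCov_nonneg (hε : IsSubGaussianNoise μ ε) (hT : 1 ≤ T) :
    0 ≤ noiseCov μ ε := by
  by_contra h
  have hu := hε.isUnit_sqrt_noiseCov hT
  have : Nonempty (Fin T) := ⟨⟨0, hT⟩⟩
  rw [CFC.sqrt_of_not_nonneg h, Matrix.det_zero] at hu
  exact not_isUnit_zero hu

theorem IsSubGaussianNoise.measurable_whiten (hε : IsSubGaussianNoise μ ε) (i : Fin d)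
    (B : Matrix (Fin T) (Fin T) ℝ) (x : Fin T → ℝ) :
    Measurable fun ω => (ε ω i ᵥ* B) ⬝ᵥ x := by
  have := hε.measurable
  simp only [Matrix.vecMul, dotProduct]
  fun_prop

/-- Needed to divide by `K ^ 2` in the Chernoff parameter. If `K = 0`, a whitened coordinate
vanishes almost everywhere, against its unit second moment. -/
theorem IsSubGaussianNoise.noiseK_pos (hε : IsSubGaussianNoise μ ε) (hT : 1 ≤ T) :
    0 < noiseK μ ε := by
  refine lt_of_le_of_ne ENNReal.toReal_nonneg fun h0 => ?_
  set t : Fin T := ⟨0, hT⟩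
  have h1 := eLpNorm_le_of_subGaussianNorm hε.whiten_subGaussian
    (x := EuclideanSpace.single t (1 : ℝ)) (by simp) (le_refl (1 : ℝ))
  have hK : (subGaussianNorm μ (whiten μ fun ω => ε ω 0)).toReal = 0 := h0.symm
  rw [hK, zero_mul, ENNReal.ofReal_zero, nonpos_iff_eq_zero] at h1
  replace h1 := (eLpNorm_eq_zero_iff
    (hε.measurable_whiten 0 _ _).aestronglyMeasurable (by simp)).1 h1
  have h2 := congrFun₂ hε.isotropic t t
  have h3 : ∫ ω, whiten μ (fun ω => ε ω 0) ω t * whiten μ (fun ω => ε ω 0) ω t ∂μ = 0 := by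
    refine integral_eq_zero_of_ae ?_
    filter_upwards [h1] with ω hω
    have : whiten μ (fun ω => ε ω 0) ω t = 0 := by
      simp only [PiLp.ofLp_single, dotProduct_single, mul_one] at hω
      exact hω
    simp [this]
  simp [secondMoment, h3] at h2

/-- With high probability, the squared operator norm of the noise is of order
`‖Σ‖ (d + T + s)`. -/
theorem IsSubGaussianNoise.exists_event [IsProbabilityMeasure μ] (hε : IsSubGaussianNoise μ ε)
    (hT : 1 ≤ T) {s : ℝ} (hs : 0 ≤ s) :
    ∃ G : Set Ω, MeasurableSet G ∧ μ Gᶜ ≤ ENNReal.ofReal (Real.exp (-s)) ∧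
      ∀ ω ∈ G, ∀ x : EuclideanSpace ℝ (Fin T), ∑ i, (ε ω i ⬝ᵥ x.ofLp) ^ 2 ≤
        100 * noiseKTilde μ ε * opNorm (noiseCov μ ε) * (d + T + s) * ‖x‖ ^ 2 := by
  set A := noiseCov μ ε with hA
  set R := CFC.sqrt A with hR
  set K := noiseK μ ε with hKdef
  have hK : 0 < K := hε.noiseK_pos hT
  have hRu : IsUnit R.det := hε.isUnit_sqrt_noiseCov hT
  set θ := (4 * Real.exp 1 * K ^ 2)⁻¹ with hθ
  have hθ0 : 0 < θ := by positivity
  -- Pays for the Chernoff factor `2 ^ d ≤ e ^ d` and the net size `5 ^ T ≤ e ^ (2T)`, leaving `e ^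
  -- (-s)`.
  set u : ℝ := d + 2 * T + s with hu
  have hu0 : 0 ≤ u := by positivity
  have hmeas := hε.measurable_whiten
  have htail (x : EuclideanSpace ℝ (Fin T)) (hx : ‖x‖ = 1) :
      μ {ω | θ⁻¹ * u ≤ ∑ i, ((ε ω i ᵥ* R⁻¹) ⬝ᵥ x.ofLp) ^ 2} ≤
        2 ^ d * ENNReal.ofReal (Real.exp (-u)) := by
    have hg : Measurable fun v : Fin T → ℝ => (v ᵥ* R⁻¹) ⬝ᵥ x.ofLp := by
      simp only [Matrix.vecMul, dotProduct]
      fun_prop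
    have h := measure_sum_sq_ge_le (μ := μ) (Z := fun i ω => (ε ω i ᵥ* R⁻¹) ⬝ᵥ x.ofLp)
      (fun i => hmeas i _ _) (hε.indep.comp (fun _ v => (v ᵥ* R⁻¹) ⬝ᵥ x.ofLp) fun _ => hg)
      hθ0 (fun i => ?_) (θ⁻¹ * u)
    · rwa [mul_inv_cancel_left₀ hθ0.ne'] at h
    · have hid := (hε.identDistrib i).comp
        (u := fun v => ENNReal.ofReal (Real.exp (θ * ((v ᵥ* R⁻¹) ⬝ᵥ x.ofLp) ^ 2))) (by fun_prop)
      refine hid.lintegral_eq.trans_le ?_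
      exact lintegral_exp_sq_le (hmeas 0 _ _) hK fun p hp =>
        eLpNorm_le_of_subGaussianNorm hε.whiten_subGaussian hx hp
  obtain ⟨N, hNcard, hN1, hN⟩ := exists_net_sphere (E := EuclideanSpace ℝ (Fin T))
  rw [finrank_euclideanSpace_fin] at hNcard
  set bad : EuclideanSpace ℝ (Fin T) → Set Ω := fun x =>
    {ω | θ⁻¹ * u ≤ ∑ i, ((ε ω i ᵥ* R⁻¹) ⬝ᵥ x.ofLp) ^ 2} with hbad
  refine ⟨(⋃ x ∈ N, bad x)ᶜ, ?_, ?_, ?_⟩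
  · refine (Finset.measurableSet_biUnion N fun x _ => ?_).compl
    refine measurableSet_le measurable_const ?_
    have := fun i => hmeas i R⁻¹ x.ofLp
    fun_prop
  · rw [compl_compl]
    calc μ (⋃ x ∈ N, bad x) ≤ ∑ x ∈ N, μ (bad x) := measure_biUnion_finset_le _ _
      _ ≤ ∑ _x ∈ N, 2 ^ d * ENNReal.ofReal (Real.exp (-u)) :=
        Finset.sum_le_sum fun x hx => htail x (hN1 x hx)
      _ = N.card * (2 ^ d * ENNReal.ofReal (Real.exp (-u))) := by simp
      _ ≤ ENNReal.ofReal (5 ^ T) * (ENNReal.ofReal (2 ^ d) * ENNReal.ofReal (Real.exp (-u))) := by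
        have h5 : (N.card : ℝ≥0∞) ≤ ENNReal.ofReal (5 ^ T) := by
          rw [ENNReal.ofReal_pow (by norm_num)]
          simp only [ENNReal.ofReal_ofNat]
          exact_mod_cast hNcard
        have h2 : (2 : ℝ≥0∞) ^ d = ENNReal.ofReal (2 ^ d) := by
          rw [ENNReal.ofReal_pow (by norm_num)]
          simp only [ENNReal.ofReal_ofNat]
        rw [h2]
        gcongr
      _ ≤ ENNReal.ofReal (Real.exp (-s)) := by
        rw [← ENNReal.ofReal_mul (by positivity), ← ENNReal.ofReal_mul (by positivity)]
        refine ENNReal.ofReal_le_ofReal ?_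
        have he := Real.exp_one_gt_d9
        have e2 : (2 : ℝ) ^ d ≤ Real.exp d := by
          rw [← Real.exp_one_pow]
          gcongr
          linarith
        have e5 : (5 : ℝ) ^ T ≤ Real.exp (2 * T) := by
          have : Real.exp (2 * T) = (Real.exp 1 ^ 2) ^ T := by
            rw [← pow_mul, Real.exp_one_pow]
            push_cast
            rfl
          rw [this]
          gcongr
          nlinarith
        calc (5 : ℝ) ^ T * (2 ^ d * Real.exp (-u))
            ≤ Real.exp (2 * T) * (Real.exp d * Real.exp (-u)) := by gcongr
          _ = Real.exp (-s) := by
            rw [← Real.exp_add, ← Real.exp_add, hu]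
            congr 1
            ring
  · intro ω hω x
    set W : Matrix (Fin d) (Fin T) ℝ := ε ω * R⁻¹ with hW
    let f : EuclideanSpace ℝ (Fin T) →L[ℝ] EuclideanSpace ℝ (Fin d) :=
      (Matrix.toEuclideanLin W).toContinuousLinearMap
    have hf (y : EuclideanSpace ℝ (Fin T)) : ‖f y‖ ^ 2 = ∑ i, (W i ⬝ᵥ y.ofLp) ^ 2 := by
      rw [EuclideanSpace.norm_sq_eq]
      simp only [Real.norm_eq_abs, sq_abs]
      rfl
    have hnet : ∀ c ∈ N, ‖f c‖ ≤ √(θ⁻¹ * u) := by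
      intro c hc
      refine Real.le_sqrt_of_sq_le ?_
      rw [hf]
      simp only [Set.mem_compl_iff, Set.mem_iUnion, not_exists, hbad, Set.mem_ofPred_eq,
        not_le] at hω
      exact (hω c hc).le
    have hop := opNorm_le_of_net hN f (Real.sqrt_nonneg _) hnet
    have hfy (y : EuclideanSpace ℝ (Fin T)) : ‖f y‖ ^ 2 ≤ 4 * (θ⁻¹ * u) * ‖y‖ ^ 2 := by
      calc ‖f y‖ ^ 2 ≤ (2 * √(θ⁻¹ * u) * ‖y‖) ^ 2 := by
            gcongr
            exact f.le_of_opNorm_le hop y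
        _ = _ := by rw [mul_pow, mul_pow, Real.sq_sqrt (by positivity)]; norm_num
    have hWR : W * R = ε ω := by rw [hW, Matrix.nonsing_inv_mul_cancel_right _ _ hRu]
    have hsum : ∑ i, (ε ω i ⬝ᵥ x.ofLp) ^ 2 = ‖f (WithLp.toLp 2 (R *ᵥ x.ofLp))‖ ^ 2 := by
      rw [hf]
      refine Finset.sum_congr rfl fun i _ => ?_
      have : (ε ω *ᵥ x.ofLp) i = (W *ᵥ (R *ᵥ x.ofLp)) i := by rw [Matrix.mulVec_mulVec, hWR]
      exact congrArg (· ^ 2) this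
    have hconst : 4 * (θ⁻¹ * u) ≤ 100 * noiseKTilde μ ε * (d + T + s) := by
      have hKt : K ^ 2 ≤ noiseKTilde μ ε := le_max_left _ _
      have he := Real.exp_one_lt_d9
      have hdn : (0 : ℝ) ≤ d := Nat.cast_nonneg d
      calc 4 * (θ⁻¹ * u) = 16 * Real.exp 1 * K ^ 2 * u := by rw [hθ, inv_inv]; ring
        -- Here `e < 3` and `u ≤ 2(d + T + s)`, so `96` would do in place of `100`.
        _ ≤ 16 * 3 * noiseKTilde μ ε * (2 * (d + T + s)) := by
          gcongr
          · exact mul_nonneg (by norm_num) ((sq_nonneg K).trans hKt)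
          · linarith
          · rw [hu]; linarith
        _ ≤ 100 * noiseKTilde μ ε * (d + T + s) := by
          have : 0 ≤ noiseKTilde μ ε * (d + T + s) :=
            mul_nonneg ((sq_nonneg K).trans hKt) (by positivity)
          nlinarith
    have hop0 : 0 ≤ opNorm A := norm_nonneg _
    rw [hsum]
    calc _ ≤ 4 * (θ⁻¹ * u) * ‖WithLp.toLp 2 (R *ᵥ x.ofLp)‖ ^ 2 := hfy _
      _ ≤ 4 * (θ⁻¹ * u) * (opNorm A * ‖x‖ ^ 2) := by
        gcongr
        exact norm_sqrt_mulVec_sq_le (hε.noiseCov_nonneg hT) x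
      _ ≤ 100 * noiseKTilde μ ε * (d + T + s) * (opNorm A * ‖x‖ ^ 2) := by gcongr
      _ = _ := by ring

end NoiseBound

end LowRankOracle

/-! ### Assembly of the oracle inequality. -/

theorem theorem3p2 :
    ∃ c : ℝ, 1 < c ∧
      ∀ (d T k : ℕ) [NeZero d] (_hT : 1 ≤ T)
        (Ω : Type*) [MeasurableSpace Ω] (μ : Measure Ω) [IsProbabilityMeasure μ]
        (M : Matrix (Fin d) (Fin T) ℝ) (ε : Ω → Matrix (Fin d) (Fin T) ℝ)
        (_hε : LowRankOracle.IsSubGaussianNoise μ ε)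
        (S : Set (Matrix (Fin d) (Fin T) ℝ)) (_hS : ∀ A ∈ S, A.rank ≤ k)
        (Mhat : Ω → Matrix (Fin d) (Fin T) ℝ)
        (_hMhat : ∀ᵐ ω ∂μ, LowRankOracle.IsLeastSquares S (M + ε ω) (Mhat ω))
        (lam s : ℝ) (_hlam0 : 0 < lam) (_hlam1 : lam < 1) (_hs : 0 ≤ s),
        ∃ G : Set Ω, MeasurableSet G ∧ 1 - 2 * Real.exp (-s) ≤ μ.real G ∧
          ∀ ω ∈ G,
            -- the oracle inequality
            (1 / ((d : ℝ) * T) * LowRankOracle.frobeniusNorm (Mhat ω - M) ^ 2 ≤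
              (1 + lam) / (1 - lam) *
                  (⨅ A : S, 1 / ((d : ℝ) * T) * LowRankOracle.frobeniusNorm (A.1 - M) ^ 2) +
                4 * c * LowRankOracle.noiseKTilde μ ε *
                    LowRankOracle.opNorm (LowRankOracle.noiseCov μ ε) / (lam * (1 - lam)) *
                  ((k : ℝ) * (d + T + s) / (d * T))) ∧
            -- the rate in the well-specified case
            (M ∈ S →
              1 / ((d : ℝ) * T) * LowRankOracle.frobeniusNorm (Mhat ω - M) ^ 2 ≤
                  4 * c * LowRankOracle.noiseKTilde μ ε *
                      LowRankOracle.opNorm (LowRankOracle.noiseCov μ ε) / (lam * (1 - lam)) *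
                    ((k : ℝ) * (d + T + s) / (d * T)) ∧
                1 / ((d : ℝ) * T) * LowRankOracle.frobeniusNorm (Mhat ω - M) ^ 2 ≤
                  4 * c * (1 + s) * LowRankOracle.noiseKTilde μ ε / (lam * (1 - lam)) *
                    (LowRankOracle.opNorm (LowRankOracle.noiseCov μ ε) *
                      ((k : ℝ) * (d + T) / (d * T)))) := by
  refine ⟨100, by norm_num, ?_⟩
  intro d T k _ hT Ω _ μ _ M ε hε S hS Mhat hMhat lam s h0 h1 hs
  obtain ⟨G, hGm, hGμ, hG⟩ := hε.exists_event hT hs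
  -- `Mhat` need not be measurable, so the exceptional null set is enlarged to a measurable one.
  set N := toMeasurable μ {ω | ¬LowRankOracle.IsLeastSquares S (M + ε ω) (Mhat ω)} with hN
  have hN0 : μ N = 0 := by rw [hN, measure_toMeasurable]; exact hMhat
  have hT0 : (0 : ℝ) < T := by exact_mod_cast hT
  have hd0 : (0 : ℝ) < d := by exact_mod_cast Nat.pos_of_ne_zero (NeZero.ne d)
  have h1' : 0 < 1 - lam := by linarith
  have hKt : 0 ≤ LowRankOracle.noiseKTilde μ ε := (sq_nonneg _).trans (le_max_left _ _)
  have hop : 0 ≤ LowRankOracle.opNorm (LowRankOracle.noiseCov μ ε) := norm_nonneg _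
  refine ⟨G \ N, hGm.diff (measurableSet_toMeasurable _ _), ?_, fun ω hω => ?_⟩
  · have hreal : μ.real G = 1 - μ.real Gᶜ := by
      rw [probReal_compl_eq_one_sub hGm]; ring
    have hc : μ.real Gᶜ ≤ Real.exp (-s) :=
      ENNReal.toReal_le_of_le_ofReal (Real.exp_pos _).le hGμ
    have hdiff : μ.real (G \ N) = μ.real G := by
      rw [Measure.real, Measure.real, measure_sdiff_null hN0]
    rw [hdiff, hreal]
    have := Real.exp_pos (-s)
    linarith
  have hLS : LowRankOracle.IsLeastSquares S (M + ε ω) (Mhat ω) := by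
    by_contra h
    exact hω.2 (subset_toMeasurable _ _ h)
  set L := 100 * LowRankOracle.noiseKTilde μ ε *
    LowRankOracle.opNorm (LowRankOracle.noiseCov μ ε) * (d + T + s) with hL
  have hL0 : 0 ≤ L := by positivity
  set R := 4 * 100 * LowRankOracle.noiseKTilde μ ε *
      LowRankOracle.opNorm (LowRankOracle.noiseCov μ ε) / (lam * (1 - lam)) *
      ((k : ℝ) * (d + T + s) / (d * T)) with hR
  have horacle (A : Matrix (Fin d) (Fin T) ℝ) (hA : A ∈ S) :
      1 / ((d : ℝ) * T) * LowRankOracle.frobeniusNorm (Mhat ω - M) ^ 2 ≤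
        (1 + lam) / (1 - lam) *
          (1 / ((d : ℝ) * T) * LowRankOracle.frobeniusNorm (A - M) ^ 2) + R := by
    have h := hLS.oracle hS hA hL0 (hG ω hω.1) h0 h1
    calc _ ≤ 1 / ((d : ℝ) * T) * ((1 + lam) / (1 - lam) *
          LowRankOracle.frobeniusNorm (A - M) ^ 2 + 4 * k * L / (lam * (1 - lam))) := by gcongr
      _ = _ := by
        rw [hR, hL]
        field_simp
  refine ⟨?_, fun hM => ?_⟩
  · have : Nonempty S := ⟨⟨Mhat ω, hLS.1⟩⟩
    rw [Real.mul_iInf_of_nonneg (by positivity), ← sub_le_iff_le_add]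
    exact le_ciInf fun A => sub_le_iff_le_add.2 (horacle A.1 A.2)
  · have h := horacle M hM
    have hz : LowRankOracle.frobeniusNorm (M - M) ^ 2 = 0 := by
      simp [LowRankOracle.frobeniusNorm_sq]
    rw [hz, mul_zero, mul_zero, zero_add] at h
    refine ⟨h, h.trans ?_⟩
    calc R = 4 * 100 * LowRankOracle.noiseKTilde μ ε *
          LowRankOracle.opNorm (LowRankOracle.noiseCov μ ε) / (lam * (1 - lam)) / (d * T) * k *
            (d + T + s) := by rw [hR]; ring
      _ ≤ 4 * 100 * LowRankOracle.noiseKTilde μ ε *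
          LowRankOracle.opNorm (LowRankOracle.noiseCov μ ε) / (lam * (1 - lam)) / (d * T) * k *
            ((1 + s) * (d + T)) := by
        gcongr
        -- This gives `s ≤ s(d + T)`, hence `d + T + s ≤ (1 + s)(d + T)`.
        have : (1 : ℝ) ≤ d + T := by
          have : (1 : ℝ) ≤ T := by exact_mod_cast hT
          linarith
        nlinarith
      _ = _ := by ring
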